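/- Let $K$ be a field. Smooth morphisms are understood to be of finite type. Let $G$ be a connected $K$-group scheme, assumed to be reduced (so that, being irreducible, it is integral and has a function field) (resp. a smooth connected $K$-group scheme). Let $K(G)$ be the function field of $G$, let $\Omega$ be an algebraic (resp. separable) closure of $K(G)$, and let $\bar K$ be an algebraic (resp. separable) closure of $K$. The fppf site of $K$ is the category of all $K$-schemes with the fppf topology; the small smooth site of $K$ is the category of smooth $K$-schemes and all $K$-morphisms between them, with the topology given by jointly surjective families of smooth morphisms. Let $\mathcal E$ be a contravariant group functor on $K$-schemes (resp. on smooth $K$-schemes, given also on $\operatorname{Spec}\Omega$ and $\operatorname{Spec}\bar K$, i.e. on some full subcategory $P$ of the category of $K$-schemes that contains the smooth $K$-schemes, $\operatorname{Spec}\Omega$ and $\operatorname{Spec}\bar K$), and let $\pi:\mathcal E\to G$ be a homomorphism of group functors. Assume: (a) $\mathcal E$ commutes with filtered direct limits of $K$-algebras (resp. of $K$-algebras with spectrum in $P$): if $A=\varinjlim_j A_j$ is a filtered direct limit of such algebras, then $\mathcal E(A)=\varinjlim_j\mathcal E(A_j)$; (b) the map $\pi(\Omega):\mathcal E(\Omega)\to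 G(\Omega)$ is surjective. Then: (1) the map $\mathcal E(\bar K)\to G(\bar K)$ is surjective; (2) there exist a finite set $I$ and an fppf (resp. smooth) covering $(V_i\to G)_{i\in I}$, i.e. a jointly surjective family of flat morphisms locally of finite presentation (resp. of smooth morphisms), such that for each $i\in I$ the arrow $V_i\to G$, considered as an element of $G(V_i)$, lifts along $\pi(V_i):\mathcal E(V_i)\to G(V_i)$. Consequently, $\pi$ is surjective for the fppf (resp. smooth) topology: for every $K$-scheme (resp. smooth $K$-scheme) $S$ and every $g\in G(S)$ there is an fppf (resp. smooth) covering $(S_j\to S)_j$ such that each restriction $g|_{S_j}\in G(S_j)$ lies in the image of $\mathcal E(S_j)$. -/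

import Mathlib

open CategoryTheory Limits AlgebraicGeometry Opposite

universe u

/-- For a scheme `G` over a field `K` and a point `η` of `G`, the residue field `κ(η)` as a
`K`-algebra, through `Spec κ(η) ⟶ G ⟶ Spec K`. -/
noncomputable instance residueFieldAlgebra {K : Type u} [Field K]
    (G : Over (Spec (CommRingCat.of K))) (η : G.left) : Algebra K (G.left.residueField η) :=
  (Spec.preimage (G.left.fromSpecResidueField η ≫ G.hom)).hom.toAlgebra

/-- `Spec A` as a `K`-scheme, for a `K`-algebra `A`. -/
noncomputable abbrev specOver (K A : Type u) [Field K] [CommRing A] [Algebra K A] :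
    Over (Spec (CommRingCat.of K)) :=
  (algSpec (CommRingCat.of K)).obj (op (CommAlgCat.of K A))

/-- The restriction `A ↦ ℰ(Spec A)` to `K`-algebras of a contravariant group functor `ℰ` on
`K`-schemes. -/
noncomputable abbrev onAlgebras {K : Type u} [Field K]
    (E : (Over (Spec (CommRingCat.of K)))ᵒᵖ ⥤ GrpCat.{u}) : CommAlgCat.{u} K ⥤ GrpCat.{u} :=
  (algSpec (CommRingCat.of K)).rightOp ⋙ E

/-- Smooth morphisms in the sense of Hartshorne: smooth, and of finite type (a smooth morphism
in the sense of Mathlib is already locally of finite presentation). -/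
def smoothFT : MorphismProperty Scheme.{u} := fun _ _ f ↦ Smooth f ∧ QuasiCompact f

instance : smoothFT.{u}.IsMultiplicative where
  id_mem _ := ⟨inferInstance, inferInstance⟩
  comp_mem _ _ h h' :=
    have := h.1; have := h.2; have := h'.1; have := h'.2
    ⟨inferInstance, inferInstance⟩

instance : smoothFT.{u}.IsStableUnderBaseChange where
  of_isPullback h hg :=
    ⟨MorphismProperty.of_isPullback h hg.1, MorphismProperty.of_isPullback h hg.2⟩

/-- The category underlying the small smooth site of `K`: smooth `K`-schemes (of finite type),
with all `K`-morphisms between them. -/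
abbrev SmoothSch (K : Type u) [Field K] := smoothFT.{u}.Over ⊤ (Spec (CommRingCat.of K))

/-- The topology of the small smooth site of `K`: the coverings are the jointly surjective
families of smooth morphisms. -/
noncomputable abbrev smallSmoothTopology (K : Type u) [Field K] :
    GrothendieckTopology (SmoothSch K) :=
  (Spec (CommRingCat.of K)).smallGrothendieckTopology (P := smoothFT) (Q := smoothFT)

section Restricted

variable {K : Type u} [Field K] (P : ObjectProperty (Over (Spec (CommRingCat.of K))))

/-- The `K`-algebras `A` such that `Spec A` belongs to the full subcategory `P` of `K`-schemes. -/
abbrev algebrasIn : ObjectProperty (CommAlgCat.{u} K) :=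
  fun A ↦ P ((algSpec (CommRingCat.of K)).obj (op A))

/-- The restriction `A ↦ ℰ(Spec A)` of a contravariant group functor `ℰ` on a full subcategory
`P` of `K`-schemes to the `K`-algebras whose spectrum belongs to `P`. -/
noncomputable abbrev onAlgebrasIn (E : P.FullSubcategoryᵒᵖ ⥤ GrpCat.{u}) :
    (algebrasIn P).FullSubcategory ⥤ GrpCat.{u} :=
  (P.lift ((algebrasIn P).ι.op ⋙ algSpec (CommRingCat.of K)) (fun A ↦ A.unop.property)).rightOp ⋙ E

/-- `ℰ` commutes with filtered direct limits of `K`-algebras: if a `K`-algebra `A` is the direct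
limit of a filtered system `(A j)` of `K`-algebras, and `Spec A` and all `Spec (A j)` belong to
`P`, then `ℰ(A)` is the direct limit of the groups `ℰ(A j)`. -/
def CommutesWithFilteredColimits (E : P.FullSubcategoryᵒᵖ ⥤ GrpCat.{u}) : Prop :=
  ∀ (J : Type u) [SmallCategory J] [IsFiltered J] (D : J ⥤ (algebrasIn P).FullSubcategory)
    (c : Cocone D), Nonempty (IsColimit ((algebrasIn P).ι.mapCocone c)) →
      Nonempty (IsColimit ((onAlgebrasIn P E).mapCocone c))

variable {P}

/-- The inclusion of the smooth `K`-schemes into a full subcategory `P` that contains them. -/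
noncomputable abbrev smoothInclusion (hP : ∀ X : SmoothSch K, P X.toComma) :
    SmoothSch K ⥤ P.FullSubcategory :=
  P.lift (MorphismProperty.Over.forget smoothFT ⊤ (Spec (CommRingCat.of K))) hP

end Restricted

/-! Let `Spec A` be an affine open of `G`, so that `A ⊆ K(G) ⊆ Ω`. By (b) the generic point `Spec Ω
⟶ Spec A ⟶ G` lifts to `ℰ(Ω)`. Since `Ω` is the filtered union of suitable `K`-subalgebras, (a)
brings the lift down to some `Spec B` (`exists_subalgebra_map_eq`). After enlarging `B`, its map to
`G` becomes the structure map to `Spec A` followed by the open immersion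
(`exists_factor_through_chart`). The enlarged ring can be chosen flat of finite type (resp. étale)
over `A` (`exists_flat_subalgebra`, `exists_etale_subalgebra`). This gives a flat (resp. smooth) `V
⟶ G` that lifts to `ℰ`, but it need not be surjective.

The group law repairs this: the product of the two pulled back lifts lifts `V × V ⟶ G × G ⟶ G`, and
this map is surjective (`surjective_tensorHom_mul`). Indeed, both coordinate maps from a fibre of
the multiplication to `G` are flat, so a maximal point of the fibre has both coordinates generic in
`G`. Flatness of `V ⟶ G` puts the generic point in the image of `V`, so that maximal point comes
from `V × V`.

So `W = V × V` alone is a covering. Pulling it back along any `S ⟶ G` gives local surjectivity.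
Pulling it back along a geometric point gives a nonempty scheme, locally of finite type (resp.
smooth) over a closed field; it has a rational point, which yields (1). -/

/-! ### Smooth algebras over a field: reducedness and rational points -/

open scoped TensorProduct in
/-- A smooth algebra over a field is reduced: the integral closure of `K` in `K[X]` is `K`, so
by smooth base change the integral closure of `S` in `S[X]` is `S`, whereas `s X` is integral
for every nilpotent `s`. -/
theorem isReduced_of_smooth_field (K S : Type*) [Field K] [CommRing S] [Algebra K S]
    [Algebra.Smooth K S] : IsReduced S := by
  refine ⟨fun s hs ↦ ?_⟩
  have hbij := TensorProduct.toIntegralClosure_bijective_of_smooth (R := K) (S := S)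
    (B := Polynomial K)
  have hint : IsIntegral S (s ⊗ₜ[K] (Polynomial.X : Polynomial K)) := by
    obtain ⟨n, hn⟩ := hs
    refine ⟨Polynomial.X ^ n, Polynomial.monic_X_pow n, ?_⟩
    rw [Polynomial.eval₂_X_pow, Algebra.TensorProduct.tmul_pow, hn, TensorProduct.zero_tmul]
  obtain ⟨y, hy⟩ := hbij.2 ⟨_, hint⟩
  have hconst : ∀ y : S ⊗[K] integralClosure K (Polynomial K), ∃ t : S,
      ((TensorProduct.toIntegralClosure K S (Polynomial K) y : _) : S ⊗[K] Polynomial K) =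
        t ⊗ₜ 1 := by
    intro y
    induction y with
    | zero => exact ⟨0, by simp⟩
    | add x y hx hy =>
      obtain ⟨a, ha⟩ := hx
      obtain ⟨b, hb⟩ := hy
      exact ⟨a + b, by simp [ha, hb, TensorProduct.add_tmul]⟩
    | tmul a b =>
      obtain ⟨c, hc⟩ : ∃ c : K, Polynomial.C c = (b : Polynomial K) := by
        obtain ⟨p, hp, hpb⟩ := b.2
        have h : p.comp (b : Polynomial K) = 0 := hpb
        rcases Polynomial.comp_eq_zero_iff.mp h with h | h
        · exact absurd h hp.ne_zero
        · exact ⟨_, h.2.symm⟩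
      refine ⟨c • a, ?_⟩
      have : ((TensorProduct.toIntegralClosure K S (Polynomial K) (a ⊗ₜ b) : _) :
        S ⊗[K] Polynomial K) = a ⊗ₜ (b : Polynomial K) := rfl
      rw [this, ← hc, TensorProduct.smul_tmul, Polynomial.smul_eq_C_mul, mul_one]
  obtain ⟨t, ht⟩ := hconst y
  rw [hy] at ht
  -- In `s ⊗ X = t ⊗ 1`, compare the coefficients of `X`.
  simpa [Polynomial.coeff_one] using congrArg
    (TensorProduct.rid K S ∘ (Polynomial.lcoeff K 1).lTensor S) ht

theorem exists_algHom_of_finiteType (k B : Type*) [Field k] [IsAlgClosed k] [CommRing B]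
    [Nontrivial B] [Algebra k B] [Algebra.FiniteType k B] : Nonempty (B →ₐ[k] k) := by
  obtain ⟨m, hm⟩ := Ideal.exists_maximal B
  let := Ideal.Quotient.field m
  have : Module.Finite k (B ⧸ m) := finite_of_finite_type_of_isJacobsonRing k (B ⧸ m)
  exact ⟨(IsAlgClosed.lift (R := k) (S := B ⧸ m) (M := k)).comp (Ideal.Quotient.mkₐ k m)⟩

-- Near a maximal ideal, `B` is étale over a polynomial ring, so its spectrum has open image in
-- affine space. As `k` is infinite, this image contains a rational point `x`. The fibre over `x` is
-- a nonzero étale algebra over the separably closed field `k`, that is, a product of copies of `k`.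
open scoped TensorProduct in
theorem exists_algHom_of_smooth (k B : Type*) [Field k] [IsSepClosed k] [CommRing B]
    [Nontrivial B] [Algebra k B] [Algebra.Smooth k B] : Nonempty (B →ₐ[k] k) := by
  obtain ⟨m, hm⟩ := Ideal.exists_maximal B
  obtain ⟨f, hf, n, _, _, _⟩ :=
    Algebra.IsSmoothAt.exists_isStandardEtale_mvPolynomial (R := k) (p := m)
  let A := MvPolynomial (Fin n) k
  let C := Localization.Away f
  have : Nontrivial C :=
    not_subsingleton_iff_nontrivial.mp fun h ↦ by
      obtain ⟨i, hi⟩ := (IsLocalization.subsingleton_iff (M := Submonoid.powers f)).mp h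
      exact hf (hm.isPrime.mem_of_pow_mem i (by rw [show f ^ i = 0 from hi]; exact m.zero_mem))
  have : Infinite k := not_finite_iff_infinite.mp fun _ ↦ not_finite k
  have hopen : IsOpen (Set.range (PrimeSpectrum.comap (algebraMap A C))) :=
    PrimeSpectrum.isOpenMap_comap_of_hasGoingDown_of_finitePresentation.isOpen_range
  obtain ⟨q₀⟩ : Nonempty (PrimeSpectrum C) := inferInstance
  obtain ⟨_, ⟨_, ⟨h, rfl⟩, rfl⟩, hq₀, hr⟩ :=
    PrimeSpectrum.isBasis_basic_opens.exists_subset_of_mem_open (Set.mem_range_self q₀) hopen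
  obtain ⟨x, hx⟩ : ∃ x : Fin n → k, MvPolynomial.eval x h ≠ 0 := by
    by_contra! H
    have : h = 0 := MvPolynomial.funext (fun x ↦ by simpa using H x)
    exact hq₀ (by rw [this]; exact Ideal.zero_mem _)
  let e : A →+* k := MvPolynomial.eval x
  obtain ⟨q, hq⟩ := hr (show (⟨RingHom.ker e, RingHom.ker_isPrime e⟩ : PrimeSpectrum A) ∈ _ from hx)
  let : Algebra A k := e.toAlgebra
  have hqk : ∀ p : A, e p = 0 → algebraMap A C p ∈ q.asIdeal := fun p hp ↦ by
    have : p ∈ (PrimeSpectrum.comap (algebraMap A C) q).asIdeal := by rw [hq]; exact hp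
    exact this
  let g : C →ₐ[A] C ⧸ q.asIdeal := Ideal.Quotient.mkₐ A q.asIdeal
  -- Since `q` lies over the kernel of evaluation at `x`, `A` acts on `C ⧸ q` through that
  -- evaluation. Hence the fibre `k ⊗[A] C` maps to `C ⧸ q` and is nonzero.
  let j : k →ₐ[A] C ⧸ q.asIdeal :=
    { toRingHom := algebraMap k (C ⧸ q.asIdeal)
      commutes' := fun p ↦ by
        have h1 := hqk (p - MvPolynomial.C (e p)) (by
          rw [map_sub]; exact sub_eq_zero.mpr (MvPolynomial.eval_C _).symm)
        rw [map_sub] at h1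
        refine ((Ideal.Quotient.eq.mpr h1).trans ?_).symm
        change _ = Ideal.Quotient.mk _ (algebraMap k C (e p))
        rw [IsScalarTower.algebraMap_apply k A C]
        rfl }
  have : Nontrivial (k ⊗[A] C) := (Algebra.TensorProduct.lift j g fun _ _ ↦ .all _ _).toRingHom.domain_nontrivial
  have : Algebra.Etale k (k ⊗[A] C) := inferInstance
  obtain ⟨p⟩ : Nonempty (PrimeSpectrum (k ⊗[A] C)) := inferInstance
  let φ : (k ⊗[A] C) →ₐ[k] k := (Pi.evalAlgHom k _ p).comp
    (Algebra.FormallyEtale.equivPiOfIsSepClosed k (k ⊗[A] C)).toAlgHom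
  let ψ : B →+* k := φ.toRingHom.comp ((Algebra.TensorProduct.includeRight (R := A) (A := k) (B := C)).toRingHom.comp
    (algebraMap B C))
  refine ⟨{ toRingHom := ψ, commutes' := fun r ↦ ?_ }⟩
  change φ (1 ⊗ₜ (algebraMap B C (algebraMap k B r))) = r
  rw [← IsScalarTower.algebraMap_apply k B C, IsScalarTower.algebraMap_apply k A C,
    Algebra.algebraMap_eq_smul_one, ← TensorProduct.smul_tmul]
  have : (algebraMap k A r) • (1 : k) = r := by
    change e (MvPolynomial.C r) * 1 = r
    rw [mul_one]; exact MvPolynomial.eval_C _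
  rw [this]
  exact φ.commutes r

/-! ### Flat and étale subalgebras of an algebraic extension of the fraction field -/

section Subalgebras

variable {A F Ω : Type*} [CommRing A] [Field F] [Field Ω] [Algebra A F]
  [IsFractionRing A F] [Algebra F Ω] [Algebra A Ω] [IsScalarTower A F Ω]

/-- Take a basis of the finite extension `F(s)`. Let `a` be a common denominator of its structure
constants and of the coordinates of `1` and of `s`. The span of the basis over `A[1/a]` is then a
ring containing `s`, free over `A[1/a]` and so flat over `A`. No noetherian hypothesis is needed. -/
theorem exists_flat_subalgebra [IsDomain A] [Algebra.IsAlgebraic F Ω] (s : Finset Ω) :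
    ∃ C : Subalgebra A Ω, Module.Flat A C ∧ Algebra.FiniteType A C ∧ ↑s ⊆ (C : Set Ω) := by
  classical
  let L := IntermediateField.adjoin F (s : Set Ω)
  have : FiniteDimensional F L := IntermediateField.finiteDimensional_adjoin fun x _ ↦
    Algebra.IsIntegral.isIntegral x
  let b := Module.finBasis F L
  let t : s → L := fun x ↦ ⟨x, IntermediateField.subset_adjoin F _ x.2⟩
  let T : Finset F := Finset.univ.biUnion fun k ↦
    (Finset.univ.image fun p : _ × _ ↦ b.repr (b p.1 * b p.2) k) ∪ {b.repr 1 k} ∪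
      (Finset.univ.image fun x : s ↦ b.repr (t x) k)
  obtain ⟨a, ha⟩ := IsLocalization.exist_integer_multiples_of_finset (nonZeroDivisors A) T
  have hpow : Submonoid.powers (a : A) ≤ nonZeroDivisors A := Submonoid.powers_le.mpr a.2
  let A' := Localization.subalgebra.ofField F (Submonoid.powers (a : A)) hpow
  have hT : ∀ t ∈ T, t ∈ A' := by
    intro t ht
    obtain ⟨c, hc⟩ := ha t ht
    refine ⟨c, a, Submonoid.mem_powers _, ?_⟩
    have ha0 : algebraMap A F a ≠ 0 :=
      IsFractionRing.to_map_ne_zero_of_mem_nonZeroDivisors a.2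
    rw [hc, Algebra.smul_def]
    field_simp
  let v : _ → Ω := fun i ↦ (b i : Ω)
  have hv : LinearIndependent F v := b.linearIndependent.map' L.val.toLinearMap
    (LinearMap.ker_eq_bot.mpr Subtype.val_injective)
  have hv' : LinearIndependent A' v := hv.restrict_scalars (by
    intro x y h
    simpa [Algebra.smul_def] using h)
  let N : Submodule A' Ω := Submodule.span A' (Set.range v)
  have hN : ∀ y : L, (∀ k, b.repr y k ∈ A') → (y : Ω) ∈ N := by
    intro y hy
    have : (y : Ω) = ∑ k, (⟨b.repr y k, hy k⟩ : A') • v k := by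
      conv_lhs => rw [← b.sum_repr y]
      rw [← IntermediateField.coe_val, map_sum]
      rfl
    rw [this]
    exact N.sum_mem fun k _ ↦ N.smul_mem _ (Submodule.subset_span ⟨k, rfl⟩)
  have h1 : (1 : Ω) ∈ N := hN 1 fun k ↦ hT _ (by
    simp only [T, Finset.mem_biUnion, Finset.mem_union]
    exact ⟨k, Finset.mem_univ _, .inl (.inr (Finset.mem_singleton_self _))⟩)
  have hmul : ∀ x y : Ω, x ∈ N → y ∈ N → x * y ∈ N := by
    intro x y hx hy
    have : x * y ∈ N * N := Submodule.mul_mem_mul hx hy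
    rw [Submodule.span_mul_span] at this
    refine Submodule.span_le.mpr ?_ this
    rintro _ ⟨_, ⟨i, rfl⟩, _, ⟨j, rfl⟩, rfl⟩
    exact hN (b i * b j) fun k ↦ hT _ (by
      simp only [T, Finset.mem_biUnion, Finset.mem_union]
      exact ⟨k, Finset.mem_univ _, .inl (.inl (Finset.mem_image.mpr ⟨(i, j), Finset.mem_univ _, rfl⟩))⟩)
  let C : Subalgebra A' Ω := N.toSubalgebra h1 hmul
  have : IsLocalization (Submonoid.powers (a : A)) A' :=
    Localization.subalgebra.isLocalization_ofField _ _ _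
  have : Module.Flat A A' := IsLocalization.flat _ (Submonoid.powers (a : A))
  have : Module.Free A' N := Module.Free.of_basis (Module.Basis.span hv')
  have hfC : Module.Free A' C := this
  have : Module.Finite A' N := Module.Finite.span_of_finite _ (Set.finite_range _)
  have hC : Module.Finite A' C := this
  have : Algebra.FiniteType A A' := IsLocalization.finiteType_of_monoid_fg (Submonoid.powers (a : A)) A'
  have hft : Algebra.FiniteType A C := .trans (S := A') ‹_› inferInstance
  refine ⟨C.restrictScalars A, Module.Flat.trans A A' C, hft, ?_⟩
  intro x hx
  exact hN (t ⟨x, hx⟩) fun k ↦ hT _ (by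
    simp only [T, Finset.mem_biUnion, Finset.mem_union]
    exact ⟨k, Finset.mem_univ _, .inr (Finset.mem_image_of_mem _ (Finset.mem_univ _))⟩)

/-- The fraction field of `B = A[s]` is separable over `F`, hence formally étale over `A`. It is the
local ring of `B` at the zero ideal, so `B` is étale over `A` there, and `B[1/f]` is étale for some
`f ≠ 0`. This localization still embeds in `Ω`. -/
theorem exists_etale_subalgebra [IsNoetherianRing A] [Algebra.IsSeparable F Ω] (s : Finset Ω) :
    ∃ C : Subalgebra A Ω, Algebra.Etale A C ∧ ↑s ⊆ (C : Set Ω) := by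
  let B := Algebra.adjoin A (s : Set Ω)
  have : Algebra.FiniteType A B := (Subalgebra.fg_iff_finiteType _).mp ⟨s, rfl⟩
  have : Algebra.FinitePresentation A B := Algebra.FinitePresentation.of_finiteType.mp ‹_›
  have hAΩ : Function.Injective (algebraMap A Ω) := by
    rw [IsScalarTower.algebraMap_eq A F Ω]
    exact (algebraMap F Ω).injective.comp (IsFractionRing.injective A F)
  have : FaithfulSMul A B := (faithfulSMul_iff_algebraMap_injective A B).mpr fun x y h ↦
    hAΩ (congrArg Subtype.val h)
  let L := FractionRing B
  have hAL : Function.Injective (algebraMap A L) := by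
    rw [IsScalarTower.algebraMap_eq A B L]
    exact (IsFractionRing.injective B L).comp (FaithfulSMul.algebraMap_injective A B)
  let : Algebra F L := (IsFractionRing.lift hAL : F →+* L).toAlgebra
  have : IsScalarTower A F L := .of_algebraMap_eq fun x ↦ (IsFractionRing.lift_algebraMap hAL x).symm
  have hBΩ : Function.Injective (algebraMap B Ω) := Subtype.val_injective
  let : Algebra L Ω := (IsFractionRing.lift hBΩ : L →+* Ω).toAlgebra
  have : IsScalarTower B L Ω := .of_algebraMap_eq fun x ↦ (IsFractionRing.lift_algebraMap hBΩ x).symm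
  have : IsScalarTower F L Ω := by
    refine .of_algebraMap_eq' ?_
    refine IsLocalization.ringHom_ext (nonZeroDivisors A) ?_
    rw [RingHom.comp_assoc, ← IsScalarTower.algebraMap_eq A F L, ← IsScalarTower.algebraMap_eq A F Ω,
      IsScalarTower.algebraMap_eq A B L, ← RingHom.comp_assoc, ← IsScalarTower.algebraMap_eq B L Ω]
    exact IsScalarTower.algebraMap_eq A B Ω
  have : Algebra.IsSeparable F L := Algebra.isSeparable_tower_bot_of_isSeparable F L Ω
  have : Algebra.FormallyEtale F L := Algebra.FormallyEtale.of_isSeparable F L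
  have : Algebra.FormallyEtale A F := Algebra.FormallyEtale.of_isLocalization (nonZeroDivisors A)
  have : Algebra.FormallyEtale A L := Algebra.FormallyEtale.comp A F L
  have : Algebra.IsEtaleAt A (⊥ : Ideal B) := by
    have : IsLocalization (⊥ : Ideal B).primeCompl L := by
      rw [Ideal.primeCompl_bot]; infer_instance
    exact Algebra.FormallyEtale.of_equiv
      ((IsLocalization.algEquiv (⊥ : Ideal B).primeCompl L (Localization.AtPrime (⊥ : Ideal B))).restrictScalars A)
  obtain ⟨f, hf, hE⟩ := Algebra.exists_etale_of_isEtaleAt (R := A) (⊥ : Ideal B)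
  have hf0 : f ≠ 0 := hf
  let φ : Localization.Away f →ₐ[A] Ω := IsLocalization.liftAlgHom (M := Submonoid.powers f) (f := B.val) (by
    rintro ⟨_, n, rfl⟩
    simpa using fun h ↦ absurd h hf0)
  have hφ : Function.Injective φ := by
    refine (IsLocalization.lift_injective_iff (M := Submonoid.powers f) _).mpr fun x y ↦ ?_
    exact (IsLocalization.injective _ (powers_le_nonZeroDivisors_of_noZeroDivisors hf0)).eq_iff.trans
      Subtype.val_injective.eq_iff.symm
  refine ⟨φ.range, Algebra.Etale.of_equiv (AlgEquiv.ofInjective φ hφ), fun x hx ↦ ?_⟩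
  refine ⟨algebraMap B _ ⟨x, Algebra.subset_adjoin hx⟩, ?_⟩
  exact IsLocalization.lift_eq _ _

end Subalgebras

/-! ### Algebra homomorphisms as morphisms of affine `K`-schemes -/

section SpecMap

variable {K : Type u} [Field K] {A B C : Type u} [CommRing A] [CommRing B] [CommRing C]
  [Algebra K A] [Algebra K B] [Algebra K C]

/-- The morphism of `K`-schemes induced by a homomorphism of `K`-algebras. -/
noncomputable abbrev specMapOver (f : A →ₐ[K] B) : specOver K B ⟶ specOver K A :=
  (algSpec (CommRingCat.of K)).map (CommAlgCat.ofHom f).op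

theorem specMapOver_comp (f : A →ₐ[K] B) (g : B →ₐ[K] C) :
    specMapOver (g.comp f) = specMapOver g ≫ specMapOver f := by
  rw [← Functor.map_comp]; rfl

theorem specMapOver_injective :
    Function.Injective (specMapOver : (A →ₐ[K] B) → (specOver K B ⟶ specOver K A)) := by
  intro f g h
  have h' : Spec.map (CommRingCat.ofHom f.toRingHom) = Spec.map (CommRingCat.ofHom g.toRingHom) :=
    congrArg (fun t ↦ t.left) h
  exact AlgHom.ext fun x ↦ congrArg (fun t : CommRingCat.of A ⟶ CommRingCat.of B ↦ t.hom x)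
    (Spec.map_injective h')

theorem specMapOver_surjective :
    Function.Surjective (specMapOver : (A →ₐ[K] B) → (specOver K B ⟶ specOver K A)) := by
  intro t
  obtain ⟨r, hr⟩ : ∃ r : CommRingCat.of A ⟶ CommRingCat.of B, Spec.map r = t.left :=
    Spec.map_surjective _
  have hw : CommRingCat.ofHom (algebraMap K A) ≫ r = CommRingCat.ofHom (algebraMap K B) := by
    apply Spec.map_injective
    rw [Spec.map_comp]
    exact (congrArg (· ≫ (specOver K A).hom) hr).trans (Over.w t)
  refine ⟨{ toRingHom := r.hom, commutes' := fun x ↦ ?_ }, Over.OverMorphism.ext hr⟩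
  exact congrArg (fun t : CommRingCat.of K ⟶ CommRingCat.of B ↦ t.hom x) hw

end SpecMap

/-! ### `Ω` as a filtered colimit of subalgebras -/

section Colimit

variable {K : Type u} [Field K] {Ω : Type u} [CommRing Ω] [Algebra K Ω]

/-- The system of the subalgebras of `Ω` with property `p`. -/
noncomputable def subalgebraSystem (p : Subalgebra K Ω → Prop) : {B // p B} ⥤ CommAlgCat.{u} K where
  obj B := CommAlgCat.of K B.1
  map {B C} h := CommAlgCat.ofHom (Subalgebra.inclusion (leOfHom h))

/-- The inclusions into `Ω` of the subalgebras with property `p`. -/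
noncomputable def subalgebraCocone (p : Subalgebra K Ω → Prop) : Cocone (subalgebraSystem p) where
  pt := CommAlgCat.of K Ω
  ι := { app B := CommAlgCat.ofHom B.1.val }

variable {p : Subalgebra K Ω → Prop}

/-- A member containing generators of two others contains both of them. Thus `p` need not be stable
under joins of subalgebras. -/
theorem directed_subalgebras (hfg : ∀ B, p B → B.FG)
    (hex : ∀ s : Finset Ω, ∃ B, p B ∧ ↑s ⊆ (B : Set Ω)) :
    Directed (· ≤ ·) fun B : {B // p B} ↦ B.1 := by
  classical
  intro B C
  obtain ⟨s, hs⟩ := hfg _ B.2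
  obtain ⟨t, ht⟩ := hfg _ C.2
  obtain ⟨D, hD, hst⟩ := hex (s ∪ t)
  rw [Finset.coe_union, Set.union_subset_iff] at hst
  exact ⟨⟨D, hD⟩, hs.symm.le.trans (Algebra.adjoin_le hst.1), ht.symm.le.trans (Algebra.adjoin_le hst.2)⟩

theorem nonempty_isColimit_subalgebraCocone (hfg : ∀ B, p B → B.FG)
    (hex : ∀ s : Finset Ω, ∃ B, p B ∧ ↑s ⊆ (B : Set Ω)) :
    Nonempty (IsColimit (subalgebraCocone p)) := by
  have hdir := directed_subalgebras hfg hex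
  have htop : (⊤ : Subalgebra K Ω) = ⨆ B : {B // p B}, B.1 := by
    refine (top_unique fun x _ ↦ ?_).symm
    obtain ⟨B, hB, hx⟩ := hex {x}
    exact le_iSup (fun B : {B // p B} ↦ B.1) ⟨B, hB⟩ (hx (by simp))
  have : Nonempty {B // p B} := let ⟨B, hB, _⟩ := hex ∅; ⟨⟨B, hB⟩⟩
  let f (s : Cocone (subalgebraSystem p)) (B : {B // p B}) : B.1 →ₐ[K] s.pt := (s.ι.app B).hom
  have hf (s : Cocone (subalgebraSystem p)) (B C : {B // p B}) (h : B.1 ≤ C.1) :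
      f s B = (f s C).comp (Subalgebra.inclusion h) :=
    (congrArg CommAlgCat.Hom.hom (s.w (homOfLE h : B ⟶ C))).symm
  let g (s : Cocone (subalgebraSystem p)) : Ω →ₐ[K] s.pt :=
    (Subalgebra.iSupLift (fun B : {B // p B} ↦ B.1) hdir (f s) (hf s) ⊤ htop.le).comp
      Subalgebra.topEquiv.symm.toAlgHom
  have hg (s : Cocone (subalgebraSystem p)) (B : {B // p B}) (x : B.1) : g s x = f s B x :=
    Subalgebra.iSupLift_mk (fun B : {B // p B} ↦ B.1) (dir := hdir) (hf := hf s) (i := B) x (Algebra.mem_top (x := (x : Ω)))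
  refine ⟨{
    desc := fun s ↦ CommAlgCat.ofHom (g s)
    fac := fun s B ↦ CommAlgCat.hom_ext (AlgHom.ext (hg s B))
    uniq := fun s m hm ↦ CommAlgCat.hom_ext (AlgHom.ext fun (x : Ω) ↦ ?_) }⟩
  obtain ⟨B, hB, hx⟩ := hex {x}
  have hxB : x ∈ B := hx (Finset.mem_coe.mpr (Finset.mem_singleton_self x))
  have := DFunLike.congr_fun (congrArg CommAlgCat.Hom.hom (hm ⟨B, hB⟩)) ⟨x, hxB⟩
  exact this.trans (hg s ⟨B, hB⟩ ⟨x, hxB⟩).symm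

variable {P : ObjectProperty (Over (Spec (CommRingCat.of K)))}

/-- The morphism in `P` induced by a homomorphism of algebras. -/
noncomputable def specMapIn {A B : Type u} [CommRing A] [CommRing B] [Algebra K A] [Algebra K B]
    (f : A →ₐ[K] B) (hA : P (specOver K A)) (hB : P (specOver K B)) :
    (⟨specOver K B, hB⟩ : P.FullSubcategory) ⟶ ⟨specOver K A, hA⟩ :=
  P.homMk (specMapOver f)

/-- Every section over `Spec Ω` of a functor that commutes with filtered direct limits comes from
a member of a cofinal system of subalgebras. -/
theorem exists_subalgebra_map_eq {E : P.FullSubcategoryᵒᵖ ⥤ GrpCat.{u}}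
    (hE : CommutesWithFilteredColimits P E) (hΩ : P (specOver K Ω))
    (hP : ∀ B, p B → P (specOver K B)) (hfg : ∀ B, p B → B.FG)
    (hex : ∀ s : Finset Ω, ∃ B, p B ∧ ↑s ⊆ (B : Set Ω)) (e : E.obj (op ⟨specOver K Ω, hΩ⟩)) :
    ∃ (B : Subalgebra K Ω) (hB : p B) (x : E.obj (op ⟨specOver K B, hP B hB⟩)),
      E.map (specMapIn B.val (hP B hB) hΩ).op x = e := by
  have : Nonempty {B // p B} := let ⟨B, hB, _⟩ := hex ∅; ⟨⟨B, hB⟩⟩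
  have : IsDirectedOrder {B // p B} := ⟨directed_subalgebras hfg hex⟩
  let D : {B // p B} ⥤ (algebrasIn P).FullSubcategory :=
    (algebrasIn P).lift (subalgebraSystem p) fun B ↦ hP _ B.2
  let c : Cocone D :=
    { pt := ⟨CommAlgCat.of K Ω, hΩ⟩
      ι := { app B := (algebrasIn P).homMk ((subalgebraCocone p).ι.app B) } }
  obtain ⟨h⟩ := hE _ D c (nonempty_isColimit_subalgebraCocone hfg hex)
  obtain ⟨B, x, hx⟩ := Concrete.isColimit_exists_rep _ h e
  exact ⟨B.1, B.2, x, hx⟩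

end Colimit

/-! ### Surjectivity of `V × V ⟶ G` for flat `V ⟶ G` -/

section MultiplicationOfGroupSchemes

open CartesianMonoidalCategory MonoidalCategory MonObj

section Shear

variable {C : Type*} [Category C] [CartesianMonoidalCategory C] (G : C) [GrpObj G]

/-- The automorphism `(x, y) ↦ (x, x y)` of `G × G`. -/
def GrpObj.shearFst : G ⊗ G ≅ G ⊗ G where
  hom := lift (fst G G) (fst G G * snd G G)
  inv := lift (fst G G) ((fst G G)⁻¹ * snd G G)
  hom_inv_id := by ext <;> simp [MonObj.comp_mul, GrpObj.comp_inv]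
  inv_hom_id := by ext <;> simp [MonObj.comp_mul]

/-- The isomorphism `(x, y) ↦ (y, x y)`. -/
def GrpObj.shearSnd : G ⊗ G ≅ G ⊗ G where
  hom := lift (snd G G) (fst G G * snd G G)
  inv := lift (snd G G * (fst G G)⁻¹) (fst G G)
  hom_inv_id := by ext <;> simp [MonObj.comp_mul, GrpObj.comp_inv]
  inv_hom_id := by ext <;> simp [MonObj.comp_mul]

end Shear

section Geometry

theorem exists_forall_specializes_imp_eq {X : Type*} [TopologicalSpace X] [QuasiSober X] [T0Space X]
    [Nonempty X] : ∃ z : X, ∀ y, y ⤳ z → y = z := by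
  obtain ⟨x⟩ := ‹Nonempty X›
  have hirr := isIrreducible_irreducibleComponent (x := x)
  have hcl := isClosed_irreducibleComponent (x := x)
  obtain ⟨z, hz⟩ := QuasiSober.sober hirr hcl
  refine ⟨z, fun y hy ↦ ?_⟩
  have h1 : irreducibleComponent x ⊆ closure {y} := hz ▸ hy.closure_subset
  have h2 := eq_irreducibleComponent isIrreducible_singleton.closure.2 h1
  exact (show IsGenericPoint y _ from h2).eq hz

/-- Generizations lift along flat maps, and `z` has no generization other than itself. -/
theorem AlgebraicGeometry.Flat.eq_of_isGenericPoint {X Y : Scheme.{u}} (f : X ⟶ Y) [Flat f]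
    {z : X} (hz : ∀ y, y ⤳ z → y = z) {ξ : Y} (hξ : IsGenericPoint ξ Set.univ) : f z = ξ := by
  obtain ⟨y, hy, rfl⟩ := Flat.generalizingMap f (hξ.specializes (Set.mem_univ (f z)))
  rw [hz y hy]

variable {K : Type u} [Field K] (G : Over (Spec (CommRingCat.of K))) [GrpObj G]

/-- The shear turns the multiplication into a projection. Hence the multiplication inherits
properties of `G ⟶ Spec K` that are stable under base change. -/
theorem isPullback_mul_fst : IsPullback μ[G].left (fst G G).left G.hom G.hom := by
  refine IsPullback.flip (IsPullback.of_iso_pullback ⟨(Over.w (fst G G)).trans (Over.w μ).symm⟩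
    ((Over.forget _).mapIso (GrpObj.shearFst G)) ?_ ?_)
  · exact congrArg CommaMorphism.left (lift_fst (fst G G) _)
  · exact congrArg CommaMorphism.left ((lift_snd (fst G G) _).trans (MonObj.mul_eq_mul G).symm)

theorem isPullback_mul_snd : IsPullback μ[G].left (snd G G).left G.hom G.hom := by
  refine IsPullback.flip (IsPullback.of_iso_pullback ⟨(Over.w (snd G G)).trans (Over.w μ).symm⟩
    ((Over.forget _).mapIso (GrpObj.shearSnd G)) ?_ ?_)
  · exact congrArg CommaMorphism.left (lift_fst (snd G G) _)
  · exact congrArg CommaMorphism.left ((lift_snd (snd G G) _).trans (MonObj.mul_eq_mul G).symm)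

variable {G} {V : Over (Spec (CommRingCat.of K))} (f : V ⟶ G)

theorem tensorHom_mul_of_morphismProperty (Q : MorphismProperty Scheme.{u}) [Q.IsMultiplicative]
    [Q.IsStableUnderBaseChange] (hf : Q f.left) (hG : Q G.hom) : Q ((f ⊗ₘ f) ≫ μ).left := by
  rw [Over.comp_left]
  refine Q.comp_mem _ _ ?_ (Q.of_isPullback (isPullback_mul_fst G).flip hG)
  exact Q.pullbackMap hf hf (Over.w f).symm (Over.w f).symm

/-- If `V ⟶ G` is flat with `V` nonempty and `G` irreducible, then `V × V ⟶ G × G ⟶ G` is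
surjective. -/
theorem surjective_tensorHom_mul [Flat f.left] [Nonempty V.left] {ξ : G.left}
    (hξ : IsGenericPoint ξ Set.univ) : Surjective ((f ⊗ₘ f) ≫ μ).left := by
  refine ⟨fun g ↦ ?_⟩
  let k := G.left.fromSpecResidueField g
  -- Each coordinate map from the fibre over `g` to `G` is a base change of `Spec κ(g) ⟶ Spec K`,
  -- hence flat.
  have hp₁ := (IsPullback.of_hasPullback k μ[G].left).paste_vert (isPullback_mul_fst G)
  have hp₂ := (IsPullback.of_hasPullback k μ[G].left).paste_vert (isPullback_mul_snd G)
  have : Nonempty (Spec (CommRingCat.of K)) := inferInstance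
  have : Nonempty G.left := ⟨g⟩
  have hsurj : Surjective (pullback.fst k μ[G].left) := by
    have : Surjective G.hom := inferInstance
    exact MorphismProperty.of_isPullback hp₁.flip this
  have : Nonempty ↑(pullback k μ[G].left) := by
    obtain ⟨z, -⟩ := hsurj.1 (IsLocalRing.closedPoint _)
    exact ⟨z⟩
  obtain ⟨z, hz⟩ := exists_forall_specializes_imp_eq (X := ↑(pullback k μ[G].left))
  have : Flat (pullback.snd k μ[G].left ≫ (fst G G).left) :=
    MorphismProperty.of_isPullback hp₁ (inferInstanceAs (Flat (k ≫ G.hom)))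
  have : Flat (pullback.snd k μ[G].left ≫ (snd G G).left) :=
    MorphismProperty.of_isPullback hp₂ (inferInstanceAs (Flat (k ≫ G.hom)))
  have h₁ := Flat.eq_of_isGenericPoint (pullback.snd k μ[G].left ≫ (fst G G).left) hz hξ
  have h₂ := Flat.eq_of_isGenericPoint (pullback.snd k μ[G].left ≫ (snd G G).left) hz hξ
  obtain ⟨v, hv⟩ := exists_forall_specializes_imp_eq (X := V.left)
  have hv := Flat.eq_of_isGenericPoint f.left hv hξ
  have hrange := Scheme.Pullback.range_map (f := V.hom) (g := V.hom) G.hom G.hom f.left f.left (𝟙 _) (by simp) (by simp)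
  -- A point of `G × G` comes from `V × V` as soon as both its coordinates come from `V`; here both
  -- are `ξ`.
  have hmem : pullback.snd k μ[G].left z ∈ Set.range (f ⊗ₘ f).left := by
    rw [Over.tensorHom_left, hrange]
    exact ⟨⟨v, hv.trans h₁.symm⟩, ⟨v, hv.trans h₂.symm⟩⟩
  obtain ⟨w, hw⟩ := hmem
  refine ⟨w, ?_⟩
  rw [Over.comp_left, Scheme.Hom.comp_apply, hw, ← Scheme.Hom.comp_apply, ← pullback.condition,
    Scheme.Hom.comp_apply]
  have : pullback.fst k μ[G].left z ∈ Set.univ := trivial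
  have h : k (pullback.fst k μ[G].left z) ∈ Set.range k := ⟨_, rfl⟩
  rw [Scheme.range_fromSpecResidueField] at h
  exact h

end Geometry

end MultiplicationOfGroupSchemes

/-! ### Finite presentation by flat descent -/

section Descent

theorem locallyOfFinitePresentation_of_isLocallyNoetherian {X Y : Scheme.{u}} (f : X ⟶ Y)
    [LocallyOfFiniteType f] [IsLocallyNoetherian Y] : LocallyOfFinitePresentation f := by
  rw [HasRingHomProperty.iff_appLE (P := @LocallyOfFinitePresentation)]
  intro U V e
  have := IsLocallyNoetherian.component_noetherian U
  exact RingHom.FinitePresentation.of_finiteType.mp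
    (HasRingHomProperty.appLE (P := @LocallyOfFiniteType) f ‹_› U V e)

/-- A faithfully flat morphism locally of finite type whose source is noetherian is locally of
finite presentation: this may be checked after base change along the morphism itself. -/
theorem locallyOfFinitePresentation_of_flat_of_surjective {X Y : Scheme.{u}} (f : X ⟶ Y) [Flat f]
    [Surjective f] [LocallyOfFiniteType f] [IsNoetherian X] : LocallyOfFinitePresentation f := by
  have : QuasiCompact f := ⟨fun _ _ _ ↦ TopologicalSpace.NoetherianSpace.isCompact _⟩
  refine MorphismProperty.of_pullback_snd_of_descendsAlong
    (Q := @Surjective ⊓ @Flat ⊓ @QuasiCompact) (g := f) ⟨⟨‹_›, ‹_›⟩, ‹_›⟩ ?_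
  exact locallyOfFinitePresentation_of_isLocallyNoetherian _

end Descent

/-! ### Rational points over closed fields -/

section RationalPoints

variable {k : Type u} [Field k] {T : Scheme.{u}} [Nonempty T] (t : T ⟶ Spec (CommRingCat.of k))

theorem exists_affineOpen_nonempty (T : Scheme.{u}) [Nonempty T] :
    ∃ U : T.Opens, IsAffineOpen U ∧ Nontrivial Γ(T, U) := by
  obtain ⟨x⟩ := ‹Nonempty T›
  obtain ⟨_, ⟨U, hU, rfl⟩, hx, -⟩ := T.isBasis_affineOpens.exists_subset_of_mem_open (Set.mem_univ x) isOpen_univ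
  have : Nonempty U := ⟨⟨x, hx⟩⟩
  exact ⟨U, hU, inferInstance⟩

/-- A morphism `T ⟶ Spec k` has a section if the coordinate ring of some affine open of `T`
admits a `k`-algebra homomorphism to `k`. -/
theorem exists_section_of_affineOpen (H : ∀ (U : T.Opens) (hU : IsAffineOpen U) [Algebra k Γ(T, U)], Nontrivial Γ(T, U) →
      Spec.map (CommRingCat.ofHom (algebraMap k Γ(T, U))) = hU.fromSpec ≫ t → Nonempty (Γ(T, U) →ₐ[k] k)) :
    ∃ s : Spec (CommRingCat.of k) ⟶ T, s ≫ t = 𝟙 _ := by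
  obtain ⟨U, hU, hΓ⟩ := exists_affineOpen_nonempty T
  let : Algebra k Γ(T, U) := (Spec.preimage (hU.fromSpec ≫ t)).hom.toAlgebra
  have h : Spec.map (CommRingCat.ofHom (algebraMap k Γ(T, U))) = hU.fromSpec ≫ t :=
    Spec.map_preimage _
  obtain ⟨φ⟩ := H U hU hΓ h
  refine ⟨Spec.map (CommRingCat.ofHom φ.toRingHom) ≫ hU.fromSpec, ?_⟩
  rw [Category.assoc, ← h, ← Spec.map_comp, ← CommRingCat.ofHom_comp,
    show φ.toRingHom.comp (algebraMap k Γ(T, U)) = RingHom.id k from φ.comp_algebraMap]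
  exact Spec.map_id _

theorem exists_section_of_locallyOfFiniteType [IsAlgClosed k] [LocallyOfFiniteType t] :
    ∃ s : Spec (CommRingCat.of k) ⟶ T, s ≫ t = 𝟙 _ := by
  refine exists_section_of_affineOpen t fun U hU _ _ h ↦ ?_
  have ht : LocallyOfFiniteType (hU.fromSpec ≫ t) := inferInstance
  have : LocallyOfFiniteType (Spec.map (CommRingCat.ofHom (algebraMap k Γ(T, U)))) := by
    rw [h]; exact ht
  rw [HasRingHomProperty.Spec_iff (P := @LocallyOfFiniteType)] at this
  have : Algebra.FiniteType k Γ(T, U) := RingHom.finiteType_algebraMap.mp this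
  exact exists_algHom_of_finiteType k _

theorem exists_section_of_smooth [IsSepClosed k] [Smooth t] :
    ∃ s : Spec (CommRingCat.of k) ⟶ T, s ≫ t = 𝟙 _ := by
  refine exists_section_of_affineOpen t fun U hU _ _ h ↦ ?_
  have ht : Smooth (hU.fromSpec ≫ t) := inferInstance
  have : Smooth (Spec.map (CommRingCat.ofHom (algebraMap k Γ(T, U)))) := by
    rw [h]; exact ht
  rw [HasRingHomProperty.Spec_iff (P := @Smooth)] at this
  have : Algebra.Smooth k Γ(T, U) := RingHom.smooth_algebraMap.mp this
  exact exists_algHom_of_smooth k _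

end RationalPoints

/-! ### Affine charts at the generic point -/

section Chart

theorem map_evaluation_fromSpec {X : Scheme.{u}} {U : X.Opens} (hU : IsAffineOpen U) (x : X)
    (hx : x ∈ U) : Spec.map (X.evaluation U x hx) ≫ hU.fromSpec = X.fromSpecResidueField x := by
  rw [Scheme.fromSpecResidueField, ← hU.fromSpecStalk_eq_fromSpecStalk hx,
    IsAffineOpen.fromSpecStalk, ← Spec.map_comp_assoc]
  rfl

/-- The stalk at the generic point is already a field, so it equals its residue field. -/
theorem isFractionRing_evaluation {X : Scheme.{u}} [IsIntegral X] {U : X.Opens}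
    (hU : IsAffineOpen U) (ξ : X) (hξ : IsGenericPoint ξ Set.univ) (hx : ξ ∈ U) :
    letI := (X.evaluation U ξ hx).hom.toAlgebra
    IsFractionRing Γ(X, U) (X.residueField ξ) := by
  obtain rfl : genericPoint X = ξ := (genericPoint_spec X).eq hξ
  have : Nonempty U := ⟨⟨_, hx⟩⟩
  let := (X.evaluation U _ hx).hom.toAlgebra
  have := functionField_isFractionRing_of_isAffineOpen X U hU
  let r : X.functionField →ₐ[Γ(X, U)] X.residueField (genericPoint X) :=
    { toRingHom := (X.residue (genericPoint X)).hom, commutes' := fun _ ↦ rfl }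
  have hr : Function.Bijective r := ⟨RingHom.injective r.toRingHom, X.residue_surjective _⟩
  exact IsLocalization.isLocalization_of_algEquiv (nonZeroDivisors Γ(X, U))
    (AlgEquiv.ofBijective r hr)

variable {K : Type u} [Field K] (G : Over (Spec (CommRingCat.of K)))

theorem exists_chart_of_isOpenImmersion (ξ : G.left) {A : Type u} [CommRing A]
    [Algebra A (G.left.residueField ξ)] (i : Spec (CommRingCat.of A) ⟶ G.left) (hopen : IsOpenImmersion i)
    (hi : Spec.map (CommRingCat.ofHom (algebraMap A (G.left.residueField ξ))) ≫ i =
      G.left.fromSpecResidueField ξ) :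
    ∃ (_ : Algebra K A) (j : specOver K A ⟶ G), IsOpenImmersion j.left ∧
      IsScalarTower K A (G.left.residueField ξ) := by
  obtain ⟨φ, hφ⟩ := Spec.map_surjective (R := CommRingCat.of K) (S := CommRingCat.of A) (i ≫ G.hom)
  let alg : Algebra K A := φ.hom.toAlgebra
  have hw : i ≫ G.hom = (specOver K A).hom := hφ.symm
  have h : Spec.preimage (G.left.fromSpecResidueField ξ ≫ G.hom) =
      φ ≫ CommRingCat.ofHom (algebraMap A (G.left.residueField ξ)) := by
    apply Spec.map_injective
    rw [Spec.map_preimage, Spec.map_comp, hφ, ← hi, Category.assoc]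
  have htower : IsScalarTower K A (G.left.residueField ξ) :=
    .of_algebraMap_eq fun x ↦ congrArg (fun t ↦ t.hom x) h
  exact ⟨alg, Over.homMk (U := specOver K A) i hw, hopen, htower⟩

/-- An integral `K`-scheme has an affine open subscheme `Spec A`, and its function field is the
fraction field of `A`. -/
theorem exists_affine_chart [IsReduced G.left] (ξ : G.left) (hξ : IsGenericPoint ξ Set.univ) :
    ∃ (A : Type u) (_ : CommRing A) (_ : IsDomain A) (_ : Algebra K A) (j : specOver K A ⟶ G)
      (_ : Algebra A (G.left.residueField ξ)), IsOpenImmersion j.left ∧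
      IsScalarTower K A (G.left.residueField ξ) ∧ IsFractionRing A (G.left.residueField ξ) := by
  have : IrreducibleSpace G.left :=
    { isPreirreducible_univ := (hξ ▸ isIrreducible_singleton.closure : IsIrreducible Set.univ).2
      toNonempty := ⟨ξ⟩ }
  have : IsIntegral G.left := isIntegral_of_irreducibleSpace_of_isReduced _
  obtain ⟨_, ⟨U, hU, rfl⟩, hx, -⟩ := G.left.isBasis_affineOpens.exists_subset_of_mem_open
    (Set.mem_univ ξ) isOpen_univ
  have : Nonempty U := ⟨⟨ξ, hx⟩⟩
  have hU : IsAffineOpen U := hU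
  have hfrac := isFractionRing_evaluation hU ξ hξ hx
  let alg := (G.left.evaluation U ξ hx).hom.toAlgebra
  obtain ⟨algK, j, hj, htower⟩ := exists_chart_of_isOpenImmersion G ξ (A := Γ(G.left, U)) hU.fromSpec
    (inferInstanceAs (IsOpenImmersion hU.fromSpec)) (map_evaluation_fromSpec hU ξ hx)
  exact ⟨Γ(G.left, U), inferInstance, inferInstance, algK, j, alg, hj, htower, hfrac⟩

end Chart

/-! ### Shrinking `Spec B` into the chart -/

section Shrink

variable {K : Type u} [Field K] {G : Over (Spec (CommRingCat.of K))} {A Ω : Type u} [CommRing A]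
  [Field Ω] [Algebra K A] [Algebra A Ω] [Algebra K Ω] [IsScalarTower K A Ω]

/-- Let `Spec A` be an affine open of `G`, and let `Spec B ⟶ G`, with `B ⊆ Ω`, extend a
morphism `Spec Ω ⟶ Spec A ⟶ G`. Then `Spec B ⟶ G` factors through `Spec A` after inverting
some element of `B`. -/
theorem exists_factor_through_chart (j : specOver K A ⟶ G) [IsOpenImmersion j.left]
    (B : Subalgebra K Ω) (g : specOver K B ⟶ G)
    (hg : specMapOver B.val ≫ g = specMapOver (IsScalarTower.toAlgHom K A Ω) ≫ j) :
    ∃ b : Ω, ∀ (C : Subalgebra K Ω) (h : B ≤ C), b ∈ C →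
      ∃ ρ : A →ₐ[K] C, specMapOver (Subalgebra.inclusion h) ≫ g = specMapOver ρ ≫ j ∧
        C.val.comp ρ = IsScalarTower.toAlgHom K A Ω := by
  let o : PrimeSpectrum Ω := ⊥
  have ho : Spec.map (CommRingCat.ofHom B.val.toRingHom) o ∈ g.left ⁻¹ᵁ j.left.opensRange := by
    have h := congrArg (fun t ↦ t.left o) hg
    refine ⟨Spec.map (CommRingCat.ofHom (algebraMap A Ω)) o, h.symm⟩
  obtain ⟨b, hb, hbU⟩ : ∃ b : B, (b : Ω) ≠ 0 ∧
      ∀ q : PrimeSpectrum B, b ∉ q.asIdeal → q ∈ g.left ⁻¹ᵁ j.left.opensRange := by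
    obtain ⟨_, ⟨_, ⟨b, rfl⟩, rfl⟩, hb, hbU⟩ :=
      PrimeSpectrum.isBasis_basic_opens.exists_subset_of_mem_open ho
        (g.left ⁻¹ᵁ j.left.opensRange).isOpen
    exact ⟨b, fun h ↦ hb h, fun q hq ↦ hbU hq⟩
  -- Once `C` contains the inverse of `b`, the map `Spec C ⟶ Spec B` lands in the basic open of `b`,
  -- which maps into the chart.
  refine ⟨(b : Ω)⁻¹, fun C hBC hbC ↦ ?_⟩
  have hrange : Set.range (specMapOver (Subalgebra.inclusion hBC) ≫ g).left ⊆ Set.range j.left := by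
    rintro _ ⟨q, rfl⟩
    refine hbU (PrimeSpectrum.comap (Subalgebra.inclusion hBC).toRingHom q) fun hq ↦ ?_
    have hq' : Subalgebra.inclusion hBC b ∈ q.asIdeal := hq
    refine q.isPrime.ne_top (Ideal.eq_top_of_isUnit_mem _ hq' (.of_mul_eq_one ⟨_, hbC⟩ ?_))
    exact Subtype.ext (mul_inv_cancel₀ hb)
  let l := IsOpenImmersion.lift j.left (specMapOver (Subalgebra.inclusion hBC) ≫ g).left hrange
  have hl : l ≫ j.left = (specMapOver (Subalgebra.inclusion hBC) ≫ g).left :=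
    IsOpenImmersion.lift_fac _ _ _
  obtain ⟨ρ, hρ⟩ := specMapOver_surjective (K := K) (A := A) (B := C) (Over.homMk l (by
    rw [← Over.w j, reassoc_of% hl]; exact Over.w _))
  have h1 : specMapOver (Subalgebra.inclusion hBC) ≫ g = specMapOver ρ ≫ j := by
    rw [hρ]; exact Over.OverMorphism.ext hl.symm
  refine ⟨ρ, h1, ?_⟩
  apply specMapOver_injective
  have : Mono j := Over.mono_of_mono_left j
  rw [← cancel_mono j, specMapOver_comp, Category.assoc, ← h1, ← Category.assoc,
    ← specMapOver_comp, ← hg]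
  rfl

end Shrink

/-! ### Lifting a flat or smooth morphism to `G` -/

section Lift

variable {K : Type u} [Field K] {G : Over (Spec (CommRingCat.of K))} [GrpObj G]
  {P : ObjectProperty (Over (Spec (CommRingCat.of K)))} {E : P.FullSubcategoryᵒᵖ ⥤ GrpCat.{u}}
  (π : E ⟶ P.ι.op ⋙ yonedaGrpObj G)

/-- The morphism `X ⟶ G` that is the image under `π` of a section of `E` over `X`. -/
noncomputable def toPoint {X : P.FullSubcategory} (x : E.obj (op X)) : X.obj ⟶ G := π.app (op X) x

theorem toPoint_map {X Y : P.FullSubcategory} (f : X ⟶ Y) (y : E.obj (op Y)) :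
    toPoint π (E.map f.op y) = f.hom ≫ toPoint π y :=
  congrArg (fun t ↦ (t.hom y : X.obj ⟶ G)) (π.naturality f.op)

open MonObj in
theorem toPoint_mul {X : P.FullSubcategory} (x y : E.obj (op X)) :
    toPoint π (x * y) = toPoint π x * toPoint π y :=
  map_mul (π.app (op X)).hom x y

theorem flat_specMapOver {A B : Type u} [CommRing A] [CommRing B] [Algebra K A] [Algebra K B]
    (f : A →ₐ[K] B) (hf : f.toRingHom.Flat) : Flat (specMapOver f).left :=
  (HasRingHomProperty.Spec_iff (P := @Flat)).mpr hf

theorem smooth_specMapOver {A B : Type u} [CommRing A] [CommRing B] [Algebra K A] [Algebra K B]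
    (f : A →ₐ[K] B) (hf : f.toRingHom.Smooth) : Smooth (specMapOver f).left :=
  (HasRingHomProperty.Spec_iff (P := @Smooth)).mpr hf

variable {A F Ω : Type u} [CommRing A] [Field F] [Field Ω] [Algebra K A] [Algebra K Ω]
  [Algebra A F] [Algebra F Ω] [Algebra A Ω] [IsScalarTower K A Ω] [IsScalarTower A F Ω]
  [IsFractionRing A F]

/-- `A` itself need not be of finite type over `K`. Since its image lies in `K[s] ⊆ C`, adding `s`
to generators of `C` over `A` gives generators over `K`. -/
theorem exists_subalgebra_le_fg_of_fg {C : Subalgebra A Ω} (hC : C.FG) {s : Finset Ω}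
    (hs : (s : Set Ω) ⊆ C) (hA : ∀ a : A, algebraMap A Ω a ∈ Algebra.adjoin K (s : Set Ω)) :
    (C.restrictScalars K).FG := by
  classical
  obtain ⟨t, ht⟩ := hC
  refine ⟨s ∪ t, le_antisymm (Algebra.adjoin_le ?_) ?_⟩
  · rw [Finset.coe_union, Set.union_subset_iff]
    exact ⟨hs, ht ▸ Algebra.subset_adjoin⟩
  · let D : Subalgebra A Ω :=
      { (Algebra.adjoin K ((s ∪ t : Finset Ω) : Set Ω)).toSubsemiring with
        algebraMap_mem' := fun a ↦ Algebra.adjoin_mono (by simp) (hA a) }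
    have : C ≤ D := by
      rw [← ht]
      refine Algebra.adjoin_le fun x hx ↦ ?_
      exact Algebra.subset_adjoin (s := ((s ∪ t : Finset Ω) : Set Ω)) (by simp [hx])
    exact this

theorem exists_flat_lift [IsDomain A] [Algebra.IsAlgebraic F Ω] (hP : ∀ X, P X)
    (hE : CommutesWithFilteredColimits P E) (j : specOver K A ⟶ G) [IsOpenImmersion j.left]
    (hπ : Function.Surjective (toPoint π (X := ⟨specOver K Ω, hP _⟩))) :
    ∃ (C : Subalgebra K Ω) (x : E.obj (op ⟨specOver K C, hP _⟩)),
      C.FG ∧ Flat (toPoint π x).left := by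
  classical
  obtain ⟨e, he⟩ := hπ (specMapOver (IsScalarTower.toAlgHom K A Ω) ≫ j)
  obtain ⟨B, hB, x, hx⟩ := exists_subalgebra_map_eq (p := Subalgebra.FG) hE (hP _) (fun _ _ ↦ hP _)
    (fun _ h ↦ h) (fun s ↦ ⟨Algebra.adjoin K s, ⟨s, rfl⟩, Algebra.subset_adjoin⟩) e
  have hg : specMapOver B.val ≫ toPoint π x = specMapOver (IsScalarTower.toAlgHom K A Ω) ≫ j := by
    rw [← he, ← hx, toPoint_map]; rfl
  obtain ⟨b, hb⟩ := exists_factor_through_chart j B (toPoint π x) hg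
  obtain ⟨s, rfl⟩ := hB
  obtain ⟨C, hflat, hft, hsC⟩ := exists_flat_subalgebra (A := A) (F := F) (insert b s)
  have hs : ((insert b s : Finset Ω) : Set Ω) ⊆ C.restrictScalars K := hsC
  rw [Finset.coe_insert, Set.insert_subset_iff] at hs
  have hBC : Algebra.adjoin K (s : Set Ω) ≤ C.restrictScalars K := Algebra.adjoin_le hs.2
  obtain ⟨ρ, hρ, hρ'⟩ := hb (C.restrictScalars K) hBC hs.1
  -- A second use of `hb`, now for `K[s, b]`, shows that this finitely generated algebra contains
  -- the image of `A`.
  obtain ⟨ρ₁, -, hρ₁⟩ := hb (Algebra.adjoin K ((insert b s : Finset Ω) : Set Ω))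
    (Algebra.adjoin_mono (by simp)) (Algebra.subset_adjoin (by simp))
  refine ⟨C.restrictScalars K, E.map (specMapIn (Subalgebra.inclusion hBC) (hP _) (hP _)).op x,
    exists_subalgebra_le_fg_of_fg (Subalgebra.fg_iff_finiteType _ |>.mpr hft) hsC fun a ↦ ?_, ?_⟩
  · rw [show algebraMap A Ω a = ρ₁ a from (DFunLike.congr_fun hρ₁ a).symm]
    exact (ρ₁ a).2
  · rw [toPoint_map]
    change Flat (specMapOver (Subalgebra.inclusion hBC) ≫ toPoint π x).left
    rw [hρ, Over.comp_left]
    have : Flat (specMapOver ρ).left := by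
      have h : algebraMap A C = ρ.toRingHom := RingHom.ext fun a ↦
        Subtype.ext (DFunLike.congr_fun hρ' a).symm
      have hflat' : (algebraMap A C).Flat := RingHom.flat_algebraMap_iff.mpr hflat
      rw [h] at hflat'
      exact flat_specMapOver ρ hflat'
    infer_instance

/-- The spectrum of a smooth algebra as an object of the small smooth site. -/
noncomputable def smoothSpec (K B : Type u) [Field K] [CommRing B] [Algebra K B]
    [Algebra.Smooth K B] : SmoothSch K where
  toComma := specOver K B
  prop := ⟨(HasRingHomProperty.Spec_iff (P := @Smooth) (φ := CommRingCat.ofHom (algebraMap K B))).mpr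
      (RingHom.smooth_algebraMap.mpr ‹_›),
    inferInstanceAs (QuasiCompact (Spec.map (CommRingCat.ofHom (algebraMap K B))))⟩

theorem exists_smooth_lift [Algebra.Smooth K A] [Algebra.IsSeparable F Ω]
    (hP : ∀ X : SmoothSch K, P X.toComma) (hΩ : P (specOver K Ω))
    (hE : CommutesWithFilteredColimits P E) (j : specOver K A ⟶ G) [IsOpenImmersion j.left]
    (hπ : Function.Surjective (toPoint π (X := ⟨specOver K Ω, hΩ⟩))) :
    ∃ (V : SmoothSch K) (x : E.obj (op ⟨V.toComma, hP V⟩)),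
      Nonempty V.left ∧ smoothFT (toPoint π x).left := by
  classical
  have : IsNoetherianRing A := Algebra.FiniteType.isNoetherianRing K A
  -- `ℰ` is only given on `P`, so the system consists of étale `A`-subalgebras: they are smooth over
  -- `K`, hence have spectra in `P`.
  let p : Subalgebra K Ω → Prop := fun B ↦
    ∃ C : Subalgebra A Ω, Algebra.Etale A C ∧ B = C.restrictScalars K
  have hpP : ∀ B, p B → P (specOver K B) := by
    rintro _ ⟨C, hC, rfl⟩
    have : Algebra.Smooth K C := Algebra.Smooth.comp K A C
    exact hP (smoothSpec K C)
  have hfg : ∀ B, p B → B.FG := by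
    rintro _ ⟨C, hC, rfl⟩
    have : Algebra.FiniteType K C := Algebra.FiniteType.trans (S := A) inferInstance inferInstance
    exact (Subalgebra.fg_iff_finiteType (C.restrictScalars K)).mpr this
  have hex : ∀ s : Finset Ω, ∃ B, p B ∧ ↑s ⊆ (B : Set Ω) := by
    intro s
    obtain ⟨C, hC, hs⟩ := exists_etale_subalgebra (A := A) (F := F) s
    exact ⟨C.restrictScalars K, ⟨C, hC, rfl⟩, hs⟩
  obtain ⟨e, he⟩ := hπ (specMapOver (IsScalarTower.toAlgHom K A Ω) ≫ j)
  obtain ⟨B, hB, x, hx⟩ := exists_subalgebra_map_eq hE hΩ hpP hfg hex e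
  have hg : specMapOver B.val ≫ toPoint π x = specMapOver (IsScalarTower.toAlgHom K A Ω) ≫ j := by
    rw [← he, ← hx, toPoint_map]; rfl
  obtain ⟨b, hb⟩ := exists_factor_through_chart j B (toPoint π x) hg
  obtain ⟨s, hs⟩ := hfg B hB
  obtain ⟨C, hC, hsC⟩ := exists_etale_subalgebra (A := A) (F := F) (insert b s)
  have hbs : ((insert b s : Finset Ω) : Set Ω) ⊆ C.restrictScalars K := hsC
  rw [Finset.coe_insert, Set.insert_subset_iff] at hbs
  have hBC : B ≤ C.restrictScalars K := hs.symm.le.trans (Algebra.adjoin_le hbs.2)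
  obtain ⟨ρ, hρ, hρ'⟩ := hb (C.restrictScalars K) hBC hbs.1
  have : Algebra.Smooth K C := Algebra.Smooth.comp K A C
  have hsm : Smooth (specMapOver ρ).left := by
    have h : algebraMap A C = ρ.toRingHom := RingHom.ext fun a ↦
      Subtype.ext (DFunLike.congr_fun hρ' a).symm
    have hC' : (algebraMap A C).Smooth := RingHom.smooth_algebraMap.mpr inferInstance
    rw [h] at hC'
    exact smooth_specMapOver ρ hC'
  have hft : smoothFT (specMapOver ρ ≫ j).left := by
    refine ⟨?_, ?_⟩
    · rw [Over.comp_left]; infer_instance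
    · have : IsNoetherianRing C := Algebra.FiniteType.isNoetherianRing K C
      have : TopologicalSpace.NoetherianSpace (specOver K C).left :=
        inferInstanceAs (TopologicalSpace.NoetherianSpace (PrimeSpectrum C))
      exact ⟨fun _ _ _ ↦ @TopologicalSpace.NoetherianSpace.isCompact _ _ this _⟩
  have hV := toPoint_map π (specMapIn (Subalgebra.inclusion hBC) (hpP B hB) (hP (smoothSpec K C))) x
  exact ⟨smoothSpec K C,
    E.map (specMapIn (Subalgebra.inclusion hBC) (hpP B hB) (hP (smoothSpec K C))).op x,
    inferInstanceAs (Nonempty (PrimeSpectrum C)),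
    (congrArg (fun t ↦ smoothFT t.left) (hV.trans hρ)).mpr hft⟩

end Lift

/-! ### Products of lifts, and lifting points through a covering -/

section Covering

variable {K : Type u} [Field K] {G : Over (Spec (CommRingCat.of K))} [GrpObj G]
  {P : ObjectProperty (Over (Spec (CommRingCat.of K)))} {E : P.FullSubcategoryᵒᵖ ⥤ GrpCat.{u}}
  (π : E ⟶ P.ι.op ⋙ yonedaGrpObj G)

-- The multiplicativity of `π` enters here: `z` is the product of the pullbacks of `x` along the two
-- projections.
open MonObj MonoidalCategory CartesianMonoidalCategory in
theorem exists_toPoint_eq_tensorHom_mul {V : P.FullSubcategory} (hVV : P (V.obj ⊗ V.obj))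
    (x : E.obj (op V)) :
    ∃ z : E.obj (op ⟨V.obj ⊗ V.obj, hVV⟩),
      toPoint π z = (toPoint π x ⊗ₘ toPoint π x) ≫ μ := by
  let p₁ : (⟨V.obj ⊗ V.obj, hVV⟩ : P.FullSubcategory) ⟶ V := P.homMk (fst _ _)
  let p₂ : (⟨V.obj ⊗ V.obj, hVV⟩ : P.FullSubcategory) ⟶ V := P.homMk (snd _ _)
  refine ⟨E.map p₁.op x * E.map p₂.op x, ?_⟩
  rw [toPoint_mul, toPoint_map, toPoint_map, Hom.mul_def, ← lift_fst_comp_snd_comp]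
  rfl

theorem exists_comp_eq_of_section {S : Scheme.{u}} {W T G : Over S} (h : W ⟶ G) (g : T ⟶ G)
    (H : ∃ s : T.left ⟶ pullback h.left g.left, s ≫ pullback.snd h.left g.left = 𝟙 _) :
    ∃ t : T ⟶ W, t ≫ h = g := by
  obtain ⟨s, hs⟩ := H
  have hw : (s ≫ pullback.fst h.left g.left) ≫ h.left = g.left := by
    rw [Category.assoc, pullback.condition, reassoc_of% hs]
  refine ⟨Over.homMk (s ≫ pullback.fst h.left g.left) ?_, Over.OverMorphism.ext hw⟩
  rw [← Over.w h, ← Category.assoc, hw, Over.w]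

theorem nonempty_pullback_of_surjective {X Y Z : Scheme.{u}} (f : X ⟶ Z) (g : Y ⟶ Z) [Surjective f]
    [Nonempty Y] : Nonempty ↑(pullback f g) := by
  obtain ⟨y⟩ := ‹Nonempty Y›
  obtain ⟨z, -⟩ := (pullback.snd f g).surjective y
  exact ⟨z⟩

theorem surjective_toPoint_of_covering {W : P.FullSubcategory} (z : E.obj (op W)) {T : P.FullSubcategory}
    (H : ∀ g : T.obj ⟶ G, ∃ s : T.obj.left ⟶ pullback (toPoint π z).left g.left,
      s ≫ pullback.snd (toPoint π z).left g.left = 𝟙 _) :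
    Function.Surjective (toPoint π (X := T)) := by
  intro g
  obtain ⟨t, ht⟩ := exists_comp_eq_of_section (toPoint π z) g (H g)
  exact ⟨E.map (P.homMk t : T ⟶ W).op z, (toPoint_map π _ z).trans ht⟩

end Covering

/-! ### Local surjectivity from a single covering -/

section LocallySurjective

variable {K : Type u} [Field K] {G : Over (Spec (CommRingCat.of K))} [GrpObj G]

/-- The pullback of `W` along `s : U ⟶ G` covers `U`, and on it `s` factors through `h`, so the
restriction of `z` lifts it. -/
theorem isLocallySurjective_fppf {E : (Over (Spec (CommRingCat.of K)))ᵒᵖ ⥤ GrpCat.{u}}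
    (π : E ⟶ yonedaGrpObj G) {W : Over (Spec (CommRingCat.of K))} (z : E.obj (op W)) (h : W ⟶ G)
    (hz : π.app (op W) z = h) [Flat h.left] [LocallyOfFinitePresentation h.left] [Surjective h.left] :
    Presheaf.IsLocallySurjective (Scheme.fppfTopology.over (Spec (CommRingCat.of K))) π where
  imageSieve_mem {U} s := by
    let s' : U ⟶ G := s
    rw [GrothendieckTopology.mem_over_iff]
    let p := pullback.snd h.left s'.left
    have hp : Presieve.singleton p ∈ Scheme.fppfPrecoverage U.left := by
      rw [Scheme.fppfPrecoverage, Scheme.singleton_mem_precoverage_iff]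
      exact ⟨p.surjective, inferInstance, inferInstance⟩
    refine Scheme.fppfTopology.superset_covering ?_ (Precoverage.generate_mem_toGrothendieck hp)
    rw [Sieve.generate_le_iff]
    rintro _ _ ⟨⟩
    rw [Sieve.overEquiv_iff]
    let q : Over.mk (p ≫ U.hom) ⟶ W := Over.homMk (pullback.fst h.left s'.left) (by
      rw [← Over.w h, pullback.condition_assoc, Over.w]; rfl)
    refine ⟨E.map q.op z, ?_⟩
    have h1 : π.app (op (Over.mk (p ≫ U.hom))) (E.map q.op z) = (q ≫ h : Over.mk (p ≫ U.hom) ⟶ G) := by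
      refine (congrArg (fun t ↦ t.hom z) (π.naturality q.op)).trans ?_
      exact congrArg (fun t : W ⟶ G ↦ (q ≫ t : Over.mk (p ≫ U.hom) ⟶ G)) hz
    refine h1.trans (Over.OverMorphism.ext ?_)
    exact pullback.condition

theorem isLocallySurjective_smallSmooth {P : ObjectProperty (Over (Spec (CommRingCat.of K)))}
    (hP : ∀ X : SmoothSch K, P X.toComma) {E : P.FullSubcategoryᵒᵖ ⥤ GrpCat.{u}}
    (π : E ⟶ P.ι.op ⋙ yonedaGrpObj G) {W : SmoothSch K} (z : E.obj (op ⟨W.toComma, hP W⟩))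
    (hz : smoothFT (toPoint π z).left) (hsurj : Surjective (toPoint π z).left) :
    Presheaf.IsLocallySurjective (smallSmoothTopology K)
      (Functor.whiskerLeft (smoothInclusion hP).op π) where
  imageSieve_mem {U} s := by
    let s' : U.toComma ⟶ G := s
    let h : W.toComma ⟶ G := toPoint π z
    have : Surjective h.left := hsurj
    let p := pullback.snd h.left s'.left
    have hp : smoothFT p := MorphismProperty.pullback_snd _ _ hz
    -- The pullback is smooth of finite type over `U`, hence over `K`, and so stays in the site.
    let V : SmoothSch K := ⟨Over.mk (p ≫ U.hom), smoothFT.comp_mem _ _ hp U.prop⟩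
    let f : V ⟶ U := MorphismProperty.Over.homMk p rfl trivial
    let q : V.toComma ⟶ W.toComma := Over.homMk (pullback.fst h.left s'.left) (by
      rw [← Over.w h, pullback.condition_assoc]
      exact congrArg (p ≫ ·) (Over.w s'))
    have hf : Presheaf.imageSieve (Functor.whiskerLeft (smoothInclusion hP).op π) s f := by
      refine ⟨E.map (P.homMk q : (⟨V.toComma, hP V⟩ : P.FullSubcategory) ⟶
        ⟨W.toComma, hP W⟩).op z, ?_⟩
      refine (toPoint_map π _ z).trans (Over.OverMorphism.ext ?_)
      exact pullback.condition
    rw [Functor.mem_restrictedTopology_iff, Scheme.overGrothendieckTopology,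
      GrothendieckTopology.mem_over_iff]
    have hcov : Presieve.singleton p ∈ Scheme.precoverage smoothFT U.left := by
      rw [Scheme.singleton_mem_precoverage_iff]
      exact ⟨p.surjective, hp⟩
    refine (Scheme.grothendieckTopology smoothFT).superset_covering ?_
      (Precoverage.generate_mem_toGrothendieck hcov)
    refine (Sieve.generate_le_iff (X := U.left) _ _).mpr ?_
    rintro _ _ ⟨⟩
    refine (Sieve.overEquiv_iff _ _).mpr ?_
    exact ⟨V, f, 𝟙 _, hf, (Category.id_comp _).symm⟩

end LocallySurjective

theorem isReduced_of_smooth {K : Type u} [Field K] {X : Scheme.{u}}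
    (f : X ⟶ Spec (CommRingCat.of K)) [Smooth f] : IsReduced X := by
  have (x : X) : _root_.IsReduced (X.presheaf.stalk x) := by
    obtain ⟨_, ⟨U, hU, rfl⟩, hx, -⟩ :=
      X.isBasis_affineOpens.exists_subset_of_mem_open (Set.mem_univ x) isOpen_univ
    have hU : IsAffineOpen U := hU
    let : Algebra K Γ(X, U) := (Spec.preimage (hU.fromSpec ≫ f)).hom.toAlgebra
    have h : Spec.map (CommRingCat.ofHom (algebraMap K Γ(X, U))) = hU.fromSpec ≫ f :=
      Spec.map_preimage _
    have hf : Smooth (hU.fromSpec ≫ f) := inferInstance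
    rw [← h, HasRingHomProperty.Spec_iff (P := @Smooth)] at hf
    have : Algebra.Smooth K Γ(X, U) := RingHom.smooth_algebraMap.mp hf
    have hred := isReduced_of_smooth_field K Γ(X, U)
    let : Algebra Γ(X, U) (X.presheaf.stalk x) := TopCat.Presheaf.algebra_section_stalk X.presheaf ⟨x, hx⟩
    have := hU.isLocalization_stalk ⟨x, hx⟩
    exact isReduced_localizationPreserves (hU.primeIdealOf ⟨x, hx⟩).asIdeal.primeCompl _ hred
  exact isReduced_of_isReduced_stalk X

/-! ### The coverings of `G` -/

section Coverings

variable {K : Type u} [Field K] {G : Over (Spec (CommRingCat.of K))} [GrpObj G]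
  {P : ObjectProperty (Over (Spec (CommRingCat.of K)))} {E : P.FullSubcategoryᵒᵖ ⥤ GrpCat.{u}}
  (π : E ⟶ P.ι.op ⋙ yonedaGrpObj G)

theorem locallyOfFiniteType_specOver (K A : Type u) [Field K] [CommRing A] [Algebra K A]
    [Algebra.FiniteType K A] : LocallyOfFiniteType (specOver K A).hom :=
  (HasRingHomProperty.Spec_iff (P := @LocallyOfFiniteType)
    (φ := CommRingCat.ofHom (algebraMap K A))).mpr (RingHom.finiteType_algebraMap.mpr ‹_›)

theorem flat_over_field {K : Type u} [Field K] {X : Scheme.{u}} (f : X ⟶ Spec (CommRingCat.of K)) :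
    Flat f := inferInstance

open MonoidalCategory CartesianMonoidalCategory MonObj in
theorem exists_fppf_covering [IsReduced G.left] {ξ : G.left} (hξ : IsGenericPoint ξ Set.univ)
    {Ω : Type u} [Field Ω] [Algebra K Ω] [Algebra (G.left.residueField ξ) Ω]
    [IsScalarTower K (G.left.residueField ξ) Ω] [Algebra.IsAlgebraic (G.left.residueField ξ) Ω]
    (hP : ∀ X, P X) (hE : CommutesWithFilteredColimits P E)
    (hπ : Function.Surjective (toPoint π (X := ⟨specOver K Ω, hP _⟩))) :
    ∃ (W : P.FullSubcategory) (z : E.obj (op W)), Flat (toPoint π z).left ∧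
      LocallyOfFinitePresentation (toPoint π z).left ∧ Surjective (toPoint π z).left ∧
      LocallyOfFiniteType (toPoint π z).left := by
  obtain ⟨A, _, _, _, j, _, hj, hA, hAF⟩ := exists_affine_chart G ξ hξ
  let : Algebra A Ω :=
    ((algebraMap (G.left.residueField ξ) Ω).comp (algebraMap A (G.left.residueField ξ))).toAlgebra
  have : IsScalarTower A (G.left.residueField ξ) Ω := IsScalarTower.of_algebraMap_eq' rfl
  have : IsScalarTower K A Ω := IsScalarTower.of_algebraMap_eq' (by
    rw [IsScalarTower.algebraMap_eq K (G.left.residueField ξ) Ω,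
      IsScalarTower.algebraMap_eq K A (G.left.residueField ξ), ← RingHom.comp_assoc]
    rfl)
  obtain ⟨C, x, hC, hx⟩ := exists_flat_lift (F := G.left.residueField ξ) π hP hE j hπ
  have : Algebra.FiniteType K C := (Subalgebra.fg_iff_finiteType C).mp hC
  have := locallyOfFiniteType_specOver K C
  have : Nonempty (specOver K C).left := inferInstanceAs (Nonempty (PrimeSpectrum C))
  let V : P.FullSubcategory := ⟨specOver K C, hP _⟩
  obtain ⟨z, hz⟩ := exists_toPoint_eq_tensorHom_mul (V := V) π (hP _) x
  have hflat : Flat ((toPoint π x ⊗ₘ toPoint π x) ≫ μ).left :=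
    tensorHom_mul_of_morphismProperty (toPoint π x) @Flat hx (flat_over_field G.hom)
  have hsurj : Surjective ((toPoint π x ⊗ₘ toPoint π x) ≫ μ).left :=
    surjective_tensorHom_mul (toPoint π x) hξ
  have hW : (specOver K C ⊗ specOver K C).hom =
    pullback.fst (specOver K C).hom (specOver K C).hom ≫ (specOver K C).hom := rfl
  have hWft : LocallyOfFiniteType (specOver K C ⊗ specOver K C).hom := by
    rw [hW]; infer_instance
  -- `G` is not assumed locally of finite type; finiteness over `G` is deduced by cancellation from
  -- finiteness over `K`.
  have hft : LocallyOfFiniteType ((toPoint π x ⊗ₘ toPoint π x) ≫ μ).left := by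
    have : LocallyOfFiniteType (((toPoint π x ⊗ₘ toPoint π x) ≫ μ).left ≫ G.hom) := by
      rw [Over.w]; exact hWft
    exact locallyOfFiniteType_of_comp _ G.hom
  have : IsNoetherian (specOver K C ⊗ specOver K C).left := by
    have := LocallyOfFiniteType.isLocallyNoetherian (specOver K C ⊗ specOver K C).hom
    have : IsAffine (pullback (specOver K C).hom (specOver K C).hom) := by
      have : IsAffine (specOver K C).left := inferInstanceAs (IsAffine (Spec (.of C)))
      infer_instance
    have : CompactSpace (specOver K C ⊗ specOver K C).left :=
      inferInstanceAs (CompactSpace ↥(pullback (specOver K C).hom (specOver K C).hom))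
    constructor
  refine ⟨_, z, ?_⟩
  rw [hz]
  exact ⟨hflat, locallyOfFinitePresentation_of_flat_of_surjective _, hsurj, hft⟩

open MonoidalCategory CartesianMonoidalCategory MonObj in
theorem exists_smooth_covering (hG : smoothFT G.hom) {ξ : G.left} (hξ : IsGenericPoint ξ Set.univ)
    {Ω : Type u} [Field Ω] [Algebra K Ω] [Algebra (G.left.residueField ξ) Ω]
    [IsScalarTower K (G.left.residueField ξ) Ω] [Algebra.IsSeparable (G.left.residueField ξ) Ω]
    (hP : ∀ X : SmoothSch K, P X.toComma) (hΩ : P (specOver K Ω))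
    (hE : CommutesWithFilteredColimits P E)
    (hπ : Function.Surjective (toPoint π (X := ⟨specOver K Ω, hΩ⟩))) :
    ∃ (W : SmoothSch K) (z : E.obj (op ⟨W.toComma, hP W⟩)), smoothFT (toPoint π z).left ∧
      Surjective (toPoint π z).left := by
  have := hG.1
  have := isReduced_of_smooth G.hom
  obtain ⟨A, _, _, _, j, _, hj, hA, hAF⟩ := exists_affine_chart G ξ hξ
  let : Algebra A Ω :=
    ((algebraMap (G.left.residueField ξ) Ω).comp (algebraMap A (G.left.residueField ξ))).toAlgebra
  have : IsScalarTower A (G.left.residueField ξ) Ω := IsScalarTower.of_algebraMap_eq' rfl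
  have : IsScalarTower K A Ω := IsScalarTower.of_algebraMap_eq' (by
    rw [IsScalarTower.algebraMap_eq K (G.left.residueField ξ) Ω,
      IsScalarTower.algebraMap_eq K A (G.left.residueField ξ), ← RingHom.comp_assoc]
    rfl)
  have : Algebra.Smooth K A := by
    have h : Smooth (j.left ≫ G.hom) := inferInstance
    rw [Over.w j] at h
    exact RingHom.smooth_algebraMap.mp ((HasRingHomProperty.Spec_iff (P := @Smooth)
      (φ := CommRingCat.ofHom (algebraMap K A))).mp h)
  obtain ⟨V, x, hV, hx⟩ := exists_smooth_lift (F := G.left.residueField ξ) π hP hΩ hE j hπ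
  let X : Over (Spec (CommRingCat.of K)) := V.toComma
  let X₂ : Over (Spec (CommRingCat.of K)) := X ⊗ X
  have hVV : smoothFT X₂.hom :=
    smoothFT.comp_mem (pullback.fst V.hom V.hom) V.hom
      (MorphismProperty.pullback_fst _ _ V.prop) V.prop
  let W : SmoothSch K := ⟨X₂, hVV⟩
  obtain ⟨z, hz⟩ := exists_toPoint_eq_tensorHom_mul (V := ⟨X, hP V⟩) π (hP W) x
  refine ⟨W, z, ?_⟩
  have : Flat (toPoint π x).left := by
    have := hx.1
    infer_instance
  have : Nonempty X.left := hV
  have h1 : smoothFT ((toPoint π x ⊗ₘ toPoint π x) ≫ μ).left :=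
    tensorHom_mul_of_morphismProperty (toPoint π x) smoothFT hx hG
  have h2 : Surjective ((toPoint π x ⊗ₘ toPoint π x) ≫ μ).left :=
    surjective_tensorHom_mul (toPoint π x) hξ
  exact (congrArg (fun t ↦ smoothFT t.left ∧ Surjective t.left) hz).mpr ⟨h1, h2⟩

end Coverings

/-! ### Points over closed fields, and the two cases of the theorem -/

theorem commutesWithFilteredColimits_of_preserves {K : Type u} [Field K]
    (E : (Over (Spec (CommRingCat.of K)))ᵒᵖ ⥤ GrpCat.{u})
    [PreservesFilteredColimitsOfSize.{u, u} (onAlgebras E)] :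
    CommutesWithFilteredColimits ⊤
      ((⊤ : ObjectProperty (Over (Spec (CommRingCat.of K)))).ι.op ⋙ E) := by
  intro J _ _ D c ⟨hc⟩
  have : PreservesColimitsOfShape J (onAlgebras E) :=
    PreservesFilteredColimitsOfSize.preserves_filtered_colimits J
  exact ⟨isColimitOfPreserves (onAlgebras E) hc⟩

theorem exists_section_pullback_of_locallyOfFiniteType {X Z : Scheme.{u}} {k : Type u} [Field k] [IsAlgClosed k]
    (f : X ⟶ Z) (g : Spec (CommRingCat.of k) ⟶ Z) [LocallyOfFiniteType f] [Surjective f] :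
    ∃ s, s ≫ pullback.snd f g = 𝟙 _ :=
  have := nonempty_pullback_of_surjective f g
  exists_section_of_locallyOfFiniteType (pullback.snd f g)

theorem surjective_toPoint_of_isAlgClosed {K : Type u} [Field K]
    {G : Over (Spec (CommRingCat.of K))} [GrpObj G]
    {P : ObjectProperty (Over (Spec (CommRingCat.of K)))} {E : P.FullSubcategoryᵒᵖ ⥤ GrpCat.{u}}
    (π : E ⟶ P.ι.op ⋙ yonedaGrpObj G) {W : P.FullSubcategory} (z : E.obj (op W))
    [LocallyOfFiniteType (toPoint π z).left] [Surjective (toPoint π z).left]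
    {k : Type u} [Field k] [Algebra K k] [IsAlgClosed k] (hk : P (specOver K k)) :
    Function.Surjective (toPoint π (X := ⟨specOver K k, hk⟩)) :=
  surjective_toPoint_of_covering π z fun g ↦
    exists_section_pullback_of_locallyOfFiniteType (k := k) (toPoint π z).left g.left

theorem exists_section_pullback_of_smooth {X Z : Scheme.{u}} {k : Type u} [Field k] [IsSepClosed k]
    (f : X ⟶ Z) (g : Spec (CommRingCat.of k) ⟶ Z) [Smooth f] [Surjective f] :
    ∃ s, s ≫ pullback.snd f g = 𝟙 _ :=
  have := nonempty_pullback_of_surjective f g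
  exists_section_of_smooth (pullback.snd f g)

theorem surjective_toPoint_of_isSepClosed {K : Type u} [Field K]
    {G : Over (Spec (CommRingCat.of K))} [GrpObj G]
    {P : ObjectProperty (Over (Spec (CommRingCat.of K)))} {E : P.FullSubcategoryᵒᵖ ⥤ GrpCat.{u}}
    (π : E ⟶ P.ι.op ⋙ yonedaGrpObj G) {W : P.FullSubcategory} (z : E.obj (op W))
    [Smooth (toPoint π z).left] [Surjective (toPoint π z).left]
    {k : Type u} [Field k] [Algebra K k] [IsSepClosed k] (hk : P (specOver K k)) :
    Function.Surjective (toPoint π (X := ⟨specOver K k, hk⟩)) :=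
  surjective_toPoint_of_covering π z fun g ↦
    exists_section_pullback_of_smooth (k := k) (toPoint π z).left g.left

/-- Lifting along a group functor `π : ℰ ⟶ G` that commutes with filtered direct limits and is
surjective on `Ω`-points, where `Ω` is an algebraic (resp. separable) closure of the function
field of `G`. The first half is the fppf case, the second half the small smooth case.

The function field `K(G)` is the residue field at the generic point `η` of `G`. In the second half
the spectra of `Ω` and of the separable closure of `K` are not objects of the small smooth site, so
that `ℰ` and `π` are given on some full subcategory `P` of `K`-schemes which contains the smooth
ones and these two spectra. -/
theorem lemma2p2 (K : Type u) [Field K] (G : Over (Spec (CommRingCat.of K))) [GrpObj G]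
    [ConnectedSpace G.left] (η : G.left) (hη : IsGenericPoint η Set.univ)
    (Ω : Type u) [Field Ω] [Algebra K Ω] [Algebra (G.left.residueField η) Ω]
    [IsScalarTower K (G.left.residueField η) Ω]
    (Kbar : Type u) [Field Kbar] [Algebra K Kbar] :
    -- the fppf case
    (∀ (_ : IsReduced G.left) (_ : IsAlgClosure (G.left.residueField η) Ω)
        (_ : IsAlgClosure K Kbar)
        (E : (Over (Spec (CommRingCat.of K)))ᵒᵖ ⥤ GrpCat.{u}) (π : E ⟶ yonedaGrpObj G),
        PreservesFilteredColimitsOfSize.{u, u} (onAlgebras E) →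
        Function.Surjective (π.app (op (specOver K Ω))) →
        Function.Surjective (π.app (op (specOver K Kbar))) ∧
        (∃ (I : Type) (_ : Finite I) (V : I → Over (Spec (CommRingCat.of K))) (f : ∀ i, V i ⟶ G),
          Presieve.ofArrows (fun i ↦ (V i).left) (fun i ↦ (f i).left) ∈
            Scheme.fppfPrecoverage G.left ∧
          ∀ i, ∃ x : E.obj (op (V i)), π.app (op (V i)) x = f i) ∧
        Presheaf.IsLocallySurjective (Scheme.fppfTopology.over (Spec (CommRingCat.of K))) π) ∧
    -- the small smooth case
    (∀ (_ : smoothFT G.hom) (_ : IsSepClosure (G.left.residueField η) Ω)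
        (_ : IsSepClosure K Kbar)
        (P : ObjectProperty (Over (Spec (CommRingCat.of K))))
        (hP : ∀ X : SmoothSch K, P X.toComma)
        (hΩ : P (specOver K Ω)) (hKbar : P (specOver K Kbar))
        (E : P.FullSubcategoryᵒᵖ ⥤ GrpCat.{u}) (π : E ⟶ P.ι.op ⋙ yonedaGrpObj G),
        CommutesWithFilteredColimits P E →
        Function.Surjective (π.app (op ⟨specOver K Ω, hΩ⟩)) →
        Function.Surjective (π.app (op ⟨specOver K Kbar, hKbar⟩)) ∧
        (∃ (I : Type) (_ : Finite I) (V : I → SmoothSch K) (f : ∀ i, (V i).toComma ⟶ G),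
          Presieve.ofArrows (fun i ↦ (V i).left) (fun i ↦ (f i).left) ∈
            Scheme.precoverage smoothFT G.left ∧
          ∀ i, ∃ x : E.obj (op ⟨(V i).toComma, hP (V i)⟩),
            π.app (op ⟨(V i).toComma, hP (V i)⟩) x = f i) ∧
        Presheaf.IsLocallySurjective (smallSmoothTopology K)
          (Functor.whiskerLeft (smoothInclusion hP).op π)) := by
  constructor
  · intro _ _ _ E π hE hπ
    -- The fppf case is treated as the case where `P` consists of all `K`-schemes.
    let E' := (⊤ : ObjectProperty (Over (Spec (CommRingCat.of K)))).ι.op ⋙ E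
    let π' : E' ⟶ (⊤ : ObjectProperty (Over (Spec (CommRingCat.of K)))).ι.op ⋙ yonedaGrpObj G :=
      Functor.whiskerLeft _ π
    have : Algebra.IsAlgebraic (G.left.residueField η) Ω := IsAlgClosure.isAlgebraic
    have : IsAlgClosed Kbar := IsAlgClosure.isAlgClosed K
    obtain ⟨W, z, hflat, hlfp, hsurj, hft⟩ := exists_fppf_covering (Ω := Ω) π' hη
      (fun _ ↦ trivial) (commutesWithFilteredColimits_of_preserves E) hπ
    let z' : E.obj (op W.obj) := z
    let h : W.obj ⟶ G := toPoint π' z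
    have hz : π.app (op W.obj) z' = h := rfl
    refine ⟨surjective_toPoint_of_isAlgClosed π' z (k := Kbar) trivial,
      ⟨Unit, inferInstance, fun _ ↦ W.obj, fun _ ↦ h, ?_, fun _ ↦ ⟨z', hz⟩⟩,
      isLocallySurjective_fppf π z' h hz⟩
    rw [Scheme.fppfPrecoverage, Scheme.ofArrows_mem_precoverage_iff]
    refine ⟨fun x ↦ ?_, fun _ ↦ ⟨hflat, hlfp⟩⟩
    obtain ⟨y, hy⟩ := h.left.surjective x
    exact ⟨(), y, hy⟩
  · intro hG _ _ P hP hΩ hKbar E π hE hπ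
    have : Algebra.IsSeparable (G.left.residueField η) Ω := IsSepClosure.separable
    have : IsSepClosed Kbar := IsSepClosure.sep_closed K
    obtain ⟨W, z, hz, hsurj⟩ := exists_smooth_covering (Ω := Ω) π hG hη hP hΩ hE hπ
    have := hz.1
    refine ⟨surjective_toPoint_of_isSepClosed π z hKbar,
      ⟨Unit, inferInstance, fun _ ↦ W, fun _ ↦ toPoint π z, ?_, fun _ ↦ ⟨z, rfl⟩⟩,
      isLocallySurjective_smallSmooth hP π z hz hsurj⟩
    rw [Scheme.ofArrows_mem_precoverage_iff]
    refine ⟨fun x ↦ ?_, fun _ ↦ hz⟩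
    obtain ⟨y, hy⟩ := (toPoint π z).left.surjective x
    exact ⟨(), y, hy⟩
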